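/- Let $n\ge 2$, let $U\subset\mathbb{C}^n$ be an open neighbourhood of $0$, and let $\omega$ be a holomorphic 1-form on $U$ with $\omega\wedge d\omega=0$ whose zero set $\mathrm{Sing}(\mathcal F)$ has codimension at least two; it defines a codimension one holomorphic foliation $\mathcal F$. Let $f$ be holomorphic on $U$ with reduced (squarefree) germ at $0$, and suppose that $V=\{f=0\}$ is invariant by $\mathcal F$, i.e. the leaf through each point of $V$ outside $\mathrm{Sing}(\mathcal F)$ is contained in $V$. Let $g,h$ be holomorphic functions and $\eta$ a holomorphic 1-form on $U$ with $$g\,\omega=h\,df+f\,\eta,$$ where at $0$ the germs $h,f$ have no common factor and the germs $g,f$ have no common factor. Let $\mathrm{Sing}_2(\mathcal F)$ be the union of the codimension two components of $\mathrm{Sing}(\mathcal F)$, put $\mathrm{Sing}(V)=\{f=0,\ df=0\}$ and $\mathrm{Sing}_2(\mathcal F,V)=\mathrm{Sing}(V)\cup(\mathrm{Sing}_2(\mathcal F)\cap V)$, and let $Z$ be a set whose germ at $0$ is an irreducible component, of codimension two, of the germ of $\mathrm{Sing}_2(\mathcal F,V)$ at $0$. Let $p\in Z$ be a generic point and $B\subset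 U$ a ball centred at $p$, in the sense that $Z$ is a codimension two submanifold near $p$, $\mathrm{Sing}_2(\mathcal F,V)\cap B=Z\cap B$ and $\mathrm{Sing}(\mathcal F)\cap B\subset Z$. Let $\Sigma_p\subset V\cap B$ be a one-dimensional section transverse to $Z$ at $p$, with $\Sigma_p\cap Z=\{p\}$: a union of finitely many (at least one) closed holomorphically parametrised discs, embedded and immersed except possibly at their common centre $p$, meeting only at $p$, and contained near $p$ in a two-dimensional complex submanifold transverse to $Z$. Let $\Gamma$ be the positive generator of $H_1(\Sigma_p\setminus\{p\},\mathbb{Z})$ (if $\Sigma_p$ has several branches, the sum of the positive generators of the branches), represented on each branch by a closed $C^1$ curve along which $g$ and $h$ do not vanish. The variational index computed with these choices is $$\mathrm{Var}(\mathcal F,V,Z)=\frac1{2\pi i}\int_\Gamma\beta ,$$ where $\beta$ is a smooth $(1,0)$-form on $B\setminus\mathrm{Sing}_2(\mathcal F,V)$ with $d\omega=\beta\wedge\omega$. Then such a form $\beta$ exists, the index does not depend on the choice of $\beta$, the form $\frac gh\,d\!\left(\frac hg\right)-\frac\eta h$ is integrable along $\Gamma$, and $$\mathrm{Var}(\mathcal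 F,V,Z)=\frac1{2\pi i}\int_\Gamma\left(\frac gh\,d\!\left(\frac hg\right)-\frac{\eta}{h}\right).$$ -/

import Mathlib

open Set Filter Topology
open scoped unitInterval

noncomputable section

namespace FoliationGerm

/-- Complex affine `n`-space with its Hermitian norm. -/
abbrev Cn (n : ℕ) : Type := EuclideanSpace ℂ (Fin n)

/-- A (1,0)-form: at each point a `ℂ`-linear functional. -/
abbrev OneForm (n : ℕ) : Type := Cn n → (Cn n →L[ℂ] ℂ)

/-- The ring `𝒪₀` of germs at `0 ∈ ℂⁿ` of holomorphic functions. -/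
def holGerms (n : ℕ) : Subring ((𝓝 (0 : Cn n)).Germ ℂ) where
  carrier := {a | ∃ F : Cn n → ℂ, AnalyticAt ℂ F 0 ∧ a = (F : (𝓝 (0 : Cn n)).Germ ℂ)}
  mul_mem' := by
    rintro _ _ ⟨F, hF, rfl⟩ ⟨G, hG, rfl⟩
    exact ⟨F * G, hF.mul hG, rfl⟩
  one_mem' := ⟨fun _ => 1, analyticAt_const, rfl⟩
  add_mem' := by
    rintro _ _ ⟨F, hF, rfl⟩ ⟨G, hG, rfl⟩
    exact ⟨F + G, hF.add hG, rfl⟩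
  zero_mem' := ⟨fun _ => 0, analyticAt_const, rfl⟩
  neg_mem' := by
    rintro _ ⟨F, hF, rfl⟩
    exact ⟨-F, hF.neg, rfl⟩

/-- The germ at `0` of a function that is holomorphic near `0`. -/
def germOf {n : ℕ} (F : Cn n → ℂ) (hF : AnalyticAt ℂ F 0) : holGerms n :=
  ⟨(F : (𝓝 (0 : Cn n)).Germ ℂ), F, hF, rfl⟩

/-- The map `F` cuts out `A` as a complex submanifold of codimension `k` near `x`. -/
def CutsOut {n k : ℕ} (F : Cn n → (Fin k → ℂ)) (A : Set (Cn n)) (x : Cn n) : Prop :=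
  AnalyticAt ℂ F x ∧ Function.Surjective (fderiv ℂ F x) ∧ ∀ᶠ y in 𝓝 x, (y ∈ A ↔ F y = 0)

/-- `x ∈ A`, and `A` is near `x` a complex submanifold of codimension `k`. -/
def IsRegularPoint {n : ℕ} (k : ℕ) (A : Set (Cn n)) (x : Cn n) : Prop :=
  x ∈ A ∧ ∃ F : Cn n → (Fin k → ℂ), CutsOut F A x

/-- The germ at `0` of the set `A` is a complex analytic germ. -/
def IsAnalyticGerm {n : ℕ} (A : Set (Cn n)) : Prop :=
  ∃ (m : ℕ) (F : Fin m → Cn n → ℂ), (∀ i, AnalyticAt ℂ (F i) 0) ∧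
    ∀ᶠ x in 𝓝 0, (x ∈ A ↔ ∀ i, F i x = 0)

/-- The germ at `0` of `A` is a (nonempty) irreducible complex analytic germ. -/
def IsIrreducibleGerm {n : ℕ} (A : Set (Cn n)) : Prop :=
  IsAnalyticGerm A ∧ 0 ∈ A ∧
    ∀ A₁ A₂ : Set (Cn n), IsAnalyticGerm A₁ → IsAnalyticGerm A₂ →
      A =ᶠ[𝓝 0] (A₁ ∪ A₂ : Set (Cn n)) → A =ᶠ[𝓝 0] A₁ ∨ A =ᶠ[𝓝 0] A₂

/-- The germ at `0` of `Z` is an irreducible component of the germ at `0` of `S`. -/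
def IsIrreducibleComponent {n : ℕ} (Z S : Set (Cn n)) : Prop :=
  IsIrreducibleGerm Z ∧ Z ≤ᶠ[𝓝 0] S ∧
    ∀ Z' : Set (Cn n), IsIrreducibleGerm Z' → Z ≤ᶠ[𝓝 0] Z' → Z' ≤ᶠ[𝓝 0] S → Z' =ᶠ[𝓝 0] Z

/-- The irreducible germ at `0` of `Z` has codimension `k`: arbitrarily close to `0` there are
points at which `Z` is a submanifold of codimension `k`. -/
def HasCodim {n : ℕ} (k : ℕ) (Z : Set (Cn n)) : Prop :=
  ∃ᶠ x in 𝓝 0, IsRegularPoint k Z x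

/-- The exterior derivative of a holomorphic 1-form, `dω(u, v) = D_u ω (v) - D_v ω (u)`. -/
def dForm {n : ℕ} (ω : OneForm n) (x u v : Cn n) : ℂ :=
  fderiv ℂ ω x u v - fderiv ℂ ω x v u

/-- The wedge product of two 1-forms at a point. -/
def wedge {n : ℕ} (α β : Cn n →L[ℂ] ℂ) (u v : Cn n) : ℂ :=
  α u * β v - α v * β u

/-- The singular set of the foliation `ω = 0` on `U`. -/
def singSet {n : ℕ} (U : Set (Cn n)) (ω : OneForm n) : Set (Cn n) :=
  {x ∈ U | ω x = 0}

/-- `ω` defines a codimension one singular holomorphic foliation on `U`: it is holomorphic,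
integrable (`ω ∧ dω = 0`), and its zero set has codimension at least two. -/
structure IsFoliation {n : ℕ} (U : Set (Cn n)) (ω : OneForm n) : Prop where
  holomorphic : AnalyticOnNhd ℂ ω U
  integrable : ∀ x ∈ U, ∀ u v w : Cn n,
    ω x u * dForm ω x v w - ω x v * dForm ω x u w + ω x w * dForm ω x u v = 0
  codim : ∀ x, ¬ IsRegularPoint 0 (singSet U ω) x ∧ ¬ IsRegularPoint 1 (singSet U ω) x

/-- The leaf through `x` of the foliation `ω = 0` on `U`, where `ω x ≠ 0`: the points that can be
joined to `x` by a `C¹` curve tangent to `ker ω` in the regular part of the foliation. -/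
def leaf {n : ℕ} (U : Set (Cn n)) (ω : OneForm n) (x : Cn n) : Set (Cn n) :=
  {y | ∃ γ : ℝ → Cn n, ContDiffOn ℝ 1 γ (Icc 0 1) ∧ γ 0 = x ∧ γ 1 = y ∧
    ∀ t ∈ Icc (0 : ℝ) 1, γ t ∈ U ∧ ω (γ t) ≠ 0 ∧ ω (γ t) (derivWithin γ (Icc 0 1) t) = 0}

/-- `V = {f = 0}` in `U`. -/
def hyp {n : ℕ} (U : Set (Cn n)) (f : Cn n → ℂ) : Set (Cn n) :=
  {x ∈ U | f x = 0}

/-- The singular set of `V = {f = 0}`, where `f` is a reduced equation. -/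
def hypSing {n : ℕ} (U : Set (Cn n)) (f : Cn n → ℂ) : Set (Cn n) :=
  {x ∈ U | f x = 0 ∧ fderiv ℂ f x = 0}

/-- `V = {f = 0}` is invariant: the leaf through a point of `V` in the regular part of the
foliation is contained in `V`. -/
def IsInvariant {n : ℕ} (U : Set (Cn n)) (ω : OneForm n) (f : Cn n → ℂ) : Prop :=
  ∀ x ∈ hyp U f, ω x ≠ 0 → leaf U ω x ⊆ hyp U f

/-- `Sing₂(𝓕)`, the union of the irreducible components of codimension two of the singular set,
that is, the closure in `U` of the points where that set is a submanifold of codimension two. -/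
def sing₂ {n : ℕ} (U : Set (Cn n)) (ω : OneForm n) : Set (Cn n) :=
  U ∩ closure {x | IsRegularPoint 2 (singSet U ω) x}

/-- `Sing₂(𝓕, V) = Sing(V) ∪ (Sing₂(𝓕) ∩ V)`. -/
def sing₂V {n : ℕ} (U : Set (Cn n)) (ω : OneForm n) (f : Cn n → ℂ) : Set (Cn n) :=
  hypSing U f ∪ (sing₂ U ω ∩ hyp U f)

/-- Saito's decomposition `g ω = h df + f η` on `U`, with holomorphic `g`, `h`, `η`, where the
germs at `0` of `h` and `f`, and those of `g` and `f`, have no common factor. -/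
structure IsSaitoDecomposition {n : ℕ} (U : Set (Cn n)) (ω : OneForm n) (f g h : Cn n → ℂ)
    (η : OneForm n) : Prop where
  g_hol : AnalyticOnNhd ℂ g U
  h_hol : AnalyticOnNhd ℂ h U
  η_hol : AnalyticOnNhd ℂ η U
  eq : ∀ x ∈ U, g x • ω x = h x • fderiv ℂ f x + f x • η x
  coprime_h : ∃ (hh : AnalyticAt ℂ h 0) (hf : AnalyticAt ℂ f 0),
    IsRelPrime (germOf h hh) (germOf f hf)
  coprime_g : ∃ (hg : AnalyticAt ℂ g 0) (hf : AnalyticAt ℂ f 0),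
    IsRelPrime (germOf g hg) (germOf f hf)

/-- `p` is a generic point of the component `Z` of `Sing₂(𝓕, V)` and `B = ball p r` is a ball
around it as in the definition of the variational index: `Z` is smooth of codimension two at `p`,
and `B` meets no other part of `Sing₂(𝓕, V)` and no other singular point of the foliation. -/
structure IsGenericBall {n : ℕ} (U : Set (Cn n)) (ω : OneForm n) (f : Cn n → ℂ)
    (Z : Set (Cn n)) (p : Cn n) (r : ℝ) : Prop where
  r_pos : 0 < r
  subset : Metric.ball p r ⊆ U
  smooth : IsRegularPoint 2 Z p
  sing₂V_eq : sing₂V U ω f ∩ Metric.ball p r = Z ∩ Metric.ball p r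
  sing_subset : singSet U ω ∩ Metric.ball p r ⊆ Z

/-- The curves `φ i` through `p = φ i 0` lie, near `p`, in a two-dimensional complex submanifold
`{G = 0}` that is transverse to `Z` at `p`. -/
def IsTransverse {n m : ℕ} (Z : Set (Cn n)) (p : Cn n) (φ : Fin m → ℂ → Cn n) : Prop :=
  ∃ (F : Cn n → (Fin 2 → ℂ)) (G : Cn n → (Fin (n - 2) → ℂ)),
    CutsOut F Z p ∧
    AnalyticAt ℂ G p ∧ Function.Surjective (fderiv ℂ G p) ∧
    (∀ u, fderiv ℂ F p u = 0 → fderiv ℂ G p u = 0 → u = 0) ∧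
    ∀ i, ∀ᶠ s in 𝓝 (0 : ℂ), G (φ i s) = 0

/-- A small one-dimensional section `Σ_p ⊆ V` transverse to `Z` at `p`, inside the ball of radius
`r` around `p`. It may be singular at `p`: it is the union of `m ≥ 1` local branches, and the `i`-th
one is the homeomorphic image of the closed unit disc under a holomorphic map `φ i` that is
immersive off `0`. Different branches meet only in `p`. -/
structure TransverseSection {n : ℕ} (U : Set (Cn n)) (f : Cn n → ℂ) (Z : Set (Cn n))
    (p : Cn n) (r : ℝ) where
  m : ℕ
  m_pos : 0 < m
  φ : Fin m → ℂ → Cn n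
  analytic : ∀ i, AnalyticOnNhd ℂ (φ i) (Metric.closedBall 0 1)
  injOn : ∀ i, InjOn (φ i) (Metric.closedBall 0 1)
  immersive : ∀ i, ∀ s ∈ Metric.closedBall (0 : ℂ) 1, s ≠ 0 → deriv (φ i) s ≠ 0
  center : ∀ i, φ i 0 = p
  mem : ∀ i, ∀ s ∈ Metric.closedBall (0 : ℂ) 1, φ i s ∈ hyp U f ∩ Metric.ball p r
  notMem : ∀ i, ∀ s ∈ Metric.closedBall (0 : ℂ) 1, s ≠ 0 → φ i s ∉ Z
  disjoint : ∀ i j, i ≠ j → ∀ s ∈ Metric.closedBall (0 : ℂ) 1,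
    ∀ t ∈ Metric.closedBall (0 : ℂ) 1, φ i s = φ j t → s = 0 ∧ t = 0
  transverse : IsTransverse Z p φ

/-- A positively oriented generator of `H₁(Σ_p \ {p}, ℤ)`: on each branch of `Σ_p` (a disc) a closed
`C¹` curve, which in the coordinate `s` of the punctured disc is a loop `δ i` with winding number
one around `0`. If `Σ_p` has several branches, this is the sum of these curves. -/
structure PositiveGenerator {n : ℕ} {U : Set (Cn n)} {f : Cn n → ℂ} {Z : Set (Cn n)}
    {p : Cn n} {r : ℝ} (S : TransverseSection U f Z p r) where
  z : Fin S.m → ℂ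
  δ : ∀ i, Path (z i) (z i)
  smooth : ∀ i, ContDiffOn ℝ 1 (δ i).extend I
  mem : ∀ i t, δ i t ∈ Metric.closedBall (0 : ℂ) 1
  ne_zero : ∀ i t, δ i t ≠ 0
  winding : ∀ i, curveIntegral (fun s : ℂ => s⁻¹ • (1 : ℂ →L[ℂ] ℂ)) (δ i)
    = 2 * Real.pi * Complex.I

namespace PositiveGenerator

variable {n : ℕ} {U : Set (Cn n)} {f : Cn n → ℂ} {Z : Set (Cn n)} {p : Cn n} {r : ℝ}
  {S : TransverseSection U f Z p r}

/-- The closed curve in `Σ_p \ {p}` on the `i`-th branch. -/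
def curve (Γ : PositiveGenerator S) (i : Fin S.m) :
    Path (S.φ i (Γ.z i)) (S.φ i (Γ.z i)) :=
  (Γ.δ i).map' (f := S.φ i) <| (S.analytic i).continuousOn.mono <| by
    rintro _ ⟨t, rfl⟩
    exact Γ.mem i t

/-- The integral over `Γ` of a (1,0)-form. -/
def integral (Γ : PositiveGenerator S) (α : OneForm n) : ℂ :=
  ∑ i, curveIntegral α (Γ.curve i)

end PositiveGenerator

/-- A smooth (1,0)-form `β` on `B* = B \ Sing₂(𝓕, V)` with `dω = β ∧ ω`, where `B = ball p r`. -/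
structure IsGodbillonForm {n : ℕ} (U : Set (Cn n)) (ω : OneForm n) (f : Cn n → ℂ)
    (p : Cn n) (r : ℝ) (β : OneForm n) : Prop where
  smooth : ContDiffOn ℝ ((⊤ : ℕ∞) : WithTop ℕ∞) β (Metric.ball p r \ sing₂V U ω f)
  eq : ∀ x ∈ Metric.ball p r \ sing₂V U ω f, ∀ u v : Cn n,
    dForm ω x u v = wedge (β x) (ω x) u v

/-- `c` is the variational index `Var(𝓕, V, Z)`, computed at the generic point `p` with the
generator `Γ`: `c = (1 / 2πi) ∫_Γ β` for a smooth (1,0)-form `β` on `B*` with `dω = β ∧ ω`. -/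
def IsVariationalIndex {n : ℕ} {U : Set (Cn n)} (ω : OneForm n) {f : Cn n → ℂ}
    {Z : Set (Cn n)} {p : Cn n} {r : ℝ} {S : TransverseSection U f Z p r}
    (Γ : PositiveGenerator S) (c : ℂ) : Prop :=
  ∃ β : OneForm n, IsGodbillonForm U ω f p r β ∧
    c = 1 / (2 * Real.pi * Complex.I) * Γ.integral β

/-- The meromorphic 1-form `(g / h) d(h / g) - η / h`. -/
def saitoForm {n : ℕ} (g h : Cn n → ℂ) (η : OneForm n) : OneForm n :=
  fun x => (g x / h x) • fderiv ℂ (fun y => h y / g y) x - (1 / h x) • η x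

end FoliationGerm

end

open Set Filter Topology
open scoped unitInterval

noncomputable section

namespace FoliationGerm

/-! The comparison is pointwise along `Γ`. If two forms solve `dω = β ∧ ω` at a point where `ω ≠ 0`,
their difference has zero wedge with `ω`, so they agree on `ker ω` (`apply_eq_of_wedge_eq`). Since
`f = 0` along `Γ`, its velocity is killed by `df`, hence by `g ω = h df`, hence by `ω`. Every
solution thus has the same integrand.

The Saito form is a solution at the points of `V` where `g, h ≠ 0`. Differentiating the
decomposition gives `dg ∧ ω + g dω = dh ∧ df + df ∧ η + f dη`; putting `f = 0` and `df = (g/h) ω`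
leaves `dω = (dh/h - dg/g - η/h) ∧ ω` (`dForm_eq_wedge_saitoForm`).

A solution on all of `B*` comes from contracting `ω ∧ dω = 0` with the Hermitian gradient of `ω`
(`dForm_eq_wedge_godbillonForm`). -/

variable {n : ℕ}

/-- Differentiating `g ω = h df + f η` and antisymmetrizing kills the Hessian of `f`. -/
theorem smul_dForm_of_decomposition {ω η : OneForm n} {f g h : Cn n → ℂ} {x : Cn n}
    (hω : AnalyticAt ℂ ω x) (hη : AnalyticAt ℂ η x) (hf : AnalyticAt ℂ f x)
    (hg : AnalyticAt ℂ g x) (hh : AnalyticAt ℂ h x)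
    (heq : ∀ᶠ y in 𝓝 x, g y • ω y = h y • fderiv ℂ f y + f y • η y) (u v : Cn n) :
    wedge (fderiv ℂ g x) (ω x) u v + g x * dForm ω x u v =
      wedge (fderiv ℂ h x) (fderiv ℂ f x) u v + wedge (fderiv ℂ f x) (η x) u v +
        f x * dForm η x u v := by
  have hl := hg.differentiableAt.hasFDerivAt.smul hω.differentiableAt.hasFDerivAt
  have hr := (hh.differentiableAt.hasFDerivAt.smul hf.fderiv.differentiableAt.hasFDerivAt).add
    (hf.differentiableAt.hasFDerivAt.smul hη.differentiableAt.hasFDerivAt)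
  have hD := hl.unique (hr.congr_of_eventuallyEq heq)
  have hsymm : fderiv ℂ (fderiv ℂ f) x u v = fderiv ℂ (fderiv ℂ f) x v u :=
    (hf.contDiffAt (n := ⊤)).isSymmSndFDerivAt (by simp) u v
  have huv := congrArg (fun L => L v) (congrArg (fun L => L u) hD)
  have hvu := congrArg (fun L => L u) (congrArg (fun L => L v) hD)
  simp at huv hvu
  simp only [wedge, dForm]
  linear_combination huv - hvu + h x * hsymm

/-- `(g/h) d(h/g)` is the logarithmic derivative of `h/g`, so it splits into the terms that the
differentiated decomposition produces. -/
theorem saitoForm_apply {g h : Cn n → ℂ} {x : Cn n} (η : OneForm n)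
    (hg : DifferentiableAt ℂ g x) (hh : DifferentiableAt ℂ h x) (hg0 : g x ≠ 0) (hh0 : h x ≠ 0)
    (u : Cn n) :
    saitoForm g h η x u = fderiv ℂ h x u / h x - fderiv ℂ g x u / g x - η x u / h x := by
  have hinv := (hasDerivAt_inv hg0).comp_hasFDerivAt x hg.hasFDerivAt
  have hd : HasFDerivAt (fun y => h y / g y)
      (h x • (-(g x ^ 2)⁻¹ • fderiv ℂ g x) + (g x)⁻¹ • fderiv ℂ h x) x :=
    hh.hasFDerivAt.mul hinv
  simp only [saitoForm, hd.fderiv]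
  simp
  field_simp
  ring

theorem analyticAt_saitoForm {g h : Cn n → ℂ} {η : OneForm n} {x : Cn n}
    (hg : AnalyticAt ℂ g x) (hh : AnalyticAt ℂ h x) (hη : AnalyticAt ℂ η x)
    (hg0 : g x ≠ 0) (hh0 : h x ≠ 0) : AnalyticAt ℂ (saitoForm g h η) x :=
  ((hg.div hh hh0).smul (hh.div hg hg0).fderiv).sub
    ((analyticAt_const.div hh hh0).smul hη)

/-- On `{f = 0}`, where `g` and `h` do not vanish, the Saito form satisfies the equation
`dω = β ∧ ω`. -/
theorem dForm_eq_wedge_saitoForm {ω η : OneForm n} {f g h : Cn n → ℂ} {x : Cn n}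
    (hω : AnalyticAt ℂ ω x) (hη : AnalyticAt ℂ η x) (hf : AnalyticAt ℂ f x)
    (hg : AnalyticAt ℂ g x) (hh : AnalyticAt ℂ h x)
    (heq : ∀ᶠ y in 𝓝 x, g y • ω y = h y • fderiv ℂ f y + f y • η y)
    (hf0 : f x = 0) (hg0 : g x ≠ 0) (hh0 : h x ≠ 0) (u v : Cn n) :
    dForm ω x u v = wedge (saitoForm g h η x) (ω x) u v := by
  have hd := smul_dForm_of_decomposition hω hη hf hg hh heq u v
  have hx := heq.self_of_nhds
  have hxu := congrArg (fun L => L u) hx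
  have hxv := congrArg (fun L => L v) hx
  simp [hf0] at hxu hxv
  -- At a zero of `f` the decomposition reads `g ω = h df`; substituting for `df` turns each
  -- remaining term of `hd` into a wedge with `ω`.
  have hfu : fderiv ℂ f x u = g x * ω x u / h x := by rw [hxu]; field_simp
  have hfv : fderiv ℂ f x v = g x * ω x v / h x := by rw [hxv]; field_simp
  simp only [wedge, saitoForm_apply η hg.differentiableAt hh.differentiableAt hg0 hh0]
  simp only [wedge, hf0, hfu, hfv] at hd
  apply mul_left_cancel₀ hg0
  field_simp at hd ⊢
  linear_combination hd

/-- Two solutions of `dω = β ∧ ω` at a point with `ω ≠ 0` agree on `ker ω`. -/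
theorem apply_eq_of_wedge_eq {α β ω : Cn n →L[ℂ] ℂ} (hω : ω ≠ 0)
    (hw : ∀ u v, wedge α ω u v = wedge β ω u v) {v : Cn n} (hv : ω v = 0) : α v = β v := by
  obtain ⟨u, hu⟩ : ∃ u, ω u ≠ 0 := by
    by_contra! hc
    exact hω (ContinuousLinearMap.ext hc)
  -- As `ω v = 0`, only `-α v * ω u` and `-β v * ω u` survive.
  have := hw u v
  simp only [wedge, hv] at this
  apply mul_right_cancel₀ hu
  linear_combination -this

/-! ### Existence of a smooth solution of `dω = β ∧ ω` -/

/-- The contraction of `dω` with a vector, as a functional. -/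
def contract (ω : OneForm n) (x u : Cn n) : Cn n →L[ℂ] ℂ :=
  fderiv ℂ ω x u - (fderiv ℂ ω x).flip u

@[simp]
theorem contract_apply (ω : OneForm n) (x u v : Cn n) : contract ω x u v = dForm ω x u v := rfl

/-- The squared Hermitian norm of `ω`. -/
def normSqForm (ω : OneForm n) (x : Cn n) : ℂ :=
  ∑ i, (starRingEnd ℂ) (ω x (EuclideanSpace.single i 1)) * ω x (EuclideanSpace.single i 1)

/-- The form `-i_u dω / ω(u)`, where `u` is the Hermitian gradient of `ω`. -/
def godbillonForm (ω : OneForm n) : OneForm n := fun x =>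
  -(normSqForm ω x)⁻¹ • ∑ i, (starRingEnd ℂ) (ω x (EuclideanSpace.single i 1)) •
    contract ω x (EuclideanSpace.single i 1)

theorem normSqForm_ne_zero {ω : OneForm n} {x : Cn n} (hx : ω x ≠ 0) : normSqForm ω x ≠ 0 := by
  have hN : normSqForm ω x =
      ((∑ i, Complex.normSq (ω x (EuclideanSpace.single i 1)) : ℝ) : ℂ) := by
    simp [normSqForm, Complex.normSq_eq_conj_mul_self]
  rw [hN, Complex.ofReal_ne_zero]
  contrapose! hx
  rw [Finset.sum_eq_zero_iff_of_nonneg fun i _ => Complex.normSq_nonneg _] at hx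
  ext v
  have hv : v = ∑ i, v i • (EuclideanSpace.single i 1 : Cn n) := by
    simpa using ((EuclideanSpace.basisFun (Fin n) ℂ).sum_repr v).symm
  rw [hv, map_sum]
  simp only [map_smul]
  refine Finset.sum_eq_zero fun i hi => ?_
  rw [Complex.normSq_eq_zero.1 (hx i hi)]
  simp

theorem dForm_eq_wedge_godbillonForm {ω : OneForm n} {x : Cn n}
    (hint : ∀ u v w : Cn n,
      ω x u * dForm ω x v w - ω x v * dForm ω x u w + ω x w * dForm ω x u v = 0)
    (hx : ω x ≠ 0) (v w : Cn n) : dForm ω x v w = wedge (godbillonForm ω x) (ω x) v w := by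
  have hN := normSqForm_ne_zero hx
  have hsum : normSqForm ω x * dForm ω x v w =
      (∑ i, (starRingEnd ℂ) (ω x (EuclideanSpace.single i 1)) *
        dForm ω x (EuclideanSpace.single i 1) w) * ω x v -
      (∑ i, (starRingEnd ℂ) (ω x (EuclideanSpace.single i 1)) *
        dForm ω x (EuclideanSpace.single i 1) v) * ω x w := by
    simp only [normSqForm, Finset.sum_mul, ← Finset.sum_sub_distrib]
    refine Finset.sum_congr rfl fun i _ => ?_
    -- Integrability contracted with the `i`-th component of the gradient.
    linear_combination (starRingEnd ℂ) (ω x (EuclideanSpace.single i 1)) *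
      hint (EuclideanSpace.single i 1) v w
  apply mul_left_cancel₀ hN
  rw [hsum]
  simp [wedge, godbillonForm]
  field_simp
  ring

/-- Conjugating the coefficients of `ω` destroys holomorphy, so smoothness holds only over `ℝ`. -/
theorem contDiffAt_godbillonForm {ω : OneForm n} {x : Cn n} (hω : AnalyticAt ℂ ω x)
    (hx : ω x ≠ 0) : ContDiffAt ℝ ((⊤ : ℕ∞) : WithTop ℕ∞) (godbillonForm ω) x := by
  have happ (v : Cn n) : ContDiffAt ℝ ((⊤ : ℕ∞) : WithTop ℕ∞) (fun y => ω y v) x :=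
    (hω.contDiffAt.clm_apply contDiffAt_const).restrict_scalars ℝ
  have hconj (v : Cn n) :
      ContDiffAt ℝ ((⊤ : ℕ∞) : WithTop ℕ∞) (fun y => (starRingEnd ℂ) (ω y v)) x :=
    Complex.conjCLE.contDiff.contDiffAt.comp x (happ v)
  have hcontract (v : Cn n) :
      ContDiffAt ℝ ((⊤ : ℕ∞) : WithTop ℕ∞) (fun y => contract ω y v) x := by
    refine ContDiffAt.restrict_scalars ℝ (𝕜' := ℂ) ?_
    have hd : ContDiffAt ℂ ((⊤ : ℕ∞) : WithTop ℕ∞) (fderiv ℂ ω) x := hω.fderiv.contDiffAt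
    refine (hd.clm_apply contDiffAt_const).sub ?_
    exact ((ContinuousLinearMap.flipₗᵢ ℂ (Cn n) (Cn n) ℂ).contDiff.contDiffAt.comp x
      hd).clm_apply contDiffAt_const
  have hN : ContDiffAt ℝ ((⊤ : ℕ∞) : WithTop ℕ∞) (normSqForm ω) x :=
    ContDiffAt.sum fun i _ => (hconj _).mul (happ _)
  exact (hN.inv (normSqForm_ne_zero hx)).neg.smul
    (ContDiffAt.sum fun i _ => (hconj _).smul (hcontract _))

theorem isGodbillonForm_godbillonForm {U : Set (Cn n)} {ω : OneForm n} (hω : IsFoliation U ω)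
    {f : Cn n → ℂ} {p : Cn n} {r : ℝ} (hU : Metric.ball p r ⊆ U)
    (hreg : ∀ x ∈ Metric.ball p r \ sing₂V U ω f, ω x ≠ 0) :
    IsGodbillonForm U ω f p r (godbillonForm ω) where
  smooth x hx := (contDiffAt_godbillonForm (hω.holomorphic x (hU hx.1))
    (hreg x hx)).contDiffWithinAt
  eq x hx := dForm_eq_wedge_godbillonForm (hω.integrable x (hU hx.1)) (hreg x hx)

theorem IsGenericBall.ne_zero {U : Set (Cn n)} {ω : OneForm n} {f : Cn n → ℂ} {Z : Set (Cn n)}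
    {p : Cn n} {r : ℝ} (hp : IsGenericBall U ω f Z p r) {x : Cn n}
    (hx : x ∈ Metric.ball p r \ sing₂V U ω f) : ω x ≠ 0 := fun h0 =>
  hx.2 (hp.sing₂V_eq.superset ⟨hp.sing_subset ⟨⟨hp.subset hx.1, h0⟩, hx.1⟩, hx.1⟩).1

/-! ### Integrals along the generator `Γ` -/

namespace PositiveGenerator

variable {U : Set (Cn n)} {f : Cn n → ℂ} {Z : Set (Cn n)} {p : Cn n} {r : ℝ}
  {S : TransverseSection U f Z p r}

theorem curve_mem (Γ : PositiveGenerator S) (i : Fin S.m) (t : I) :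
    Γ.curve i t ∈ hyp U f ∩ Metric.ball p r :=
  S.mem i _ (Γ.mem i t)

theorem curve_notMem (Γ : PositiveGenerator S) (i : Fin S.m) (t : I) : Γ.curve i t ∉ Z :=
  S.notMem i _ (Γ.mem i t) (Γ.ne_zero i t)

theorem contDiffOn_curve (Γ : PositiveGenerator S) (i : Fin S.m) :
    ContDiffOn ℝ 1 (Γ.curve i).extend I := by
  have hφ : ContDiffOn ℝ 1 (S.φ i) (Metric.closedBall 0 1) := fun s hs =>
    ((S.analytic i s hs).contDiffAt.restrict_scalars ℝ).contDiffWithinAt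
  refine (hφ.comp (Γ.smooth i) fun t ht => ?_).congr fun t ht => ?_
  · rw [Path.extend_apply _ ht]
    exact Γ.mem i _
  · rw [Path.extend_apply _ ht, Function.comp_apply, Path.extend_apply _ ht]
    rfl

/-- The curves of `Γ` are tangent to `{f = 0}`. -/
theorem fderiv_curve_eq_zero (Γ : PositiveGenerator S) (hf : AnalyticOnNhd ℂ f U) (i : Fin S.m)
    {t : ℝ} (ht : t ∈ I) :
    fderiv ℂ f ((Γ.curve i).extend t) (derivWithin (Γ.curve i).extend I t) = 0 := by
  have hmem (s : ℝ) (hs : s ∈ I) : (Γ.curve i).extend s ∈ hyp U f := by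
    rw [Path.extend_apply _ hs]
    exact (Γ.curve_mem i _).1
  have hγ := ((Γ.contDiffOn_curve i).differentiableOn one_ne_zero t ht).hasDerivWithinAt
  have hd := ((hf _ (hmem t ht).1).differentiableAt.hasFDerivAt.restrictScalars
    ℝ).comp_hasDerivWithinAt t hγ
  have h0 : HasDerivWithinAt (f ∘ (Γ.curve i).extend) 0 I t :=
    (hasDerivWithinAt_const t I (0 : ℂ)).congr (fun s hs => (hmem s hs).2) (hmem t ht).2
  exact (uniqueDiffOn_Icc_zero_one t ht).eq_deriv _ hd h0

theorem integral_congr (Γ : PositiveGenerator S) {α β : OneForm n}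
    (h : ∀ i, ∀ t ∈ I, α ((Γ.curve i).extend t) (derivWithin (Γ.curve i).extend I t) =
      β ((Γ.curve i).extend t) (derivWithin (Γ.curve i).extend I t)) :
    Γ.integral α = Γ.integral β := by
  refine Finset.sum_congr rfl fun i _ => ?_
  rw [curveIntegral_def, curveIntegral_def]
  refine intervalIntegral.integral_congr fun t ht => ?_
  rw [uIcc_of_le zero_le_one] at ht
  simpa only [curveIntegralFun_def] using h i t ht

/-- The poles lie in `{g h = 0}`, which `Γ` avoids, so the form is continuous on the image of each
`C¹` curve. -/
theorem curveIntegrable_saitoForm (Γ : PositiveGenerator S) {g h : Cn n → ℂ} {η : OneForm n}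
    (hg : AnalyticOnNhd ℂ g U) (hh : AnalyticOnNhd ℂ h U) (hη : AnalyticOnNhd ℂ η U)
    (hΓ : ∀ i t, g (Γ.curve i t) ≠ 0 ∧ h (Γ.curve i t) ≠ 0) (i : Fin S.m) :
    CurveIntegrable (saitoForm g h η) (Γ.curve i) := by
  refine ContinuousOn.curveIntegrable_of_contDiffOn (s := range (Γ.curve i)) ?_
    (Γ.contDiffOn_curve i) fun t => mem_range_self t
  rintro _ ⟨t, rfl⟩
  have hU := (Γ.curve_mem i t).1.1
  exact (analyticAt_saitoForm (hg _ hU) (hh _ hU) (hη _ hU) (hΓ i t).1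
    (hΓ i t).2).continuousAt.continuousWithinAt

/-- All solutions of `dω = β ∧ ω` have the same integral over `Γ` as the Saito form. -/
theorem integral_eq_integral_saitoForm (Γ : PositiveGenerator S) (hU : IsOpen U) {ω : OneForm n}
    (hω : IsFoliation U ω) (hf : AnalyticOnNhd ℂ f U) {g h : Cn n → ℂ} {η : OneForm n}
    (hS : IsSaitoDecomposition U ω f g h η) (hp : IsGenericBall U ω f Z p r)
    (hΓ : ∀ i t, g (Γ.curve i t) ≠ 0 ∧ h (Γ.curve i t) ≠ 0) {β : OneForm n}
    (hβ : IsGodbillonForm U ω f p r β) :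
    Γ.integral β = Γ.integral (saitoForm g h η) := by
  refine Γ.integral_congr fun i t ht => ?_
  have htan := Γ.fderiv_curve_eq_zero hf i ht
  revert htan
  -- Only a point `x` of `V` and a vector `v` with `df(v) = 0` matter from here on.
  generalize derivWithin (Γ.curve i).extend I t = v
  rw [Path.extend_apply _ ht]
  obtain ⟨hg0, hh0⟩ := hΓ i ⟨t, ht⟩
  obtain ⟨⟨hxU, hf0⟩, hxB⟩ := Γ.curve_mem i ⟨t, ht⟩
  have hxZ := Γ.curve_notMem i ⟨t, ht⟩
  generalize Γ.curve i ⟨t, ht⟩ = x at *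
  intro htan
  have hx : x ∈ Metric.ball p r \ sing₂V U ω f :=
    ⟨hxB, fun hs => hxZ (hp.sing₂V_eq.subset ⟨hs, hxB⟩).1⟩
  have hωv : ω x v = 0 := by
    have := congrArg (fun L => L v) (hS.eq x hxU)
    simpa [hf0, htan, hg0] using this
  refine apply_eq_of_wedge_eq (hp.ne_zero hx) (fun u w => ?_) hωv
  rw [← hβ.eq x hx, dForm_eq_wedge_saitoForm (hω.holomorphic x hxU) (hS.η_hol x hxU) (hf x hxU)
    (hS.g_hol x hxU) (hS.h_hol x hxU) (eventually_of_mem (hU.mem_nhds hxU) hS.eq) hf0 hg0 hh0]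

end PositiveGenerator

end FoliationGerm

end

theorem mainTheorem7 {n : ℕ} (hn : 2 ≤ n)
    (U : Set (FoliationGerm.Cn n)) (hU : IsOpen U) (h0 : 0 ∈ U)
    (ω : FoliationGerm.OneForm n) (hω : FoliationGerm.IsFoliation U ω)
    (f : FoliationGerm.Cn n → ℂ) (hf : AnalyticOnNhd ℂ f U)
    (hred : Squarefree (FoliationGerm.germOf f (hf 0 h0)))
    (hinv : FoliationGerm.IsInvariant U ω f)
    (Z : Set (FoliationGerm.Cn n))
    (hZ : FoliationGerm.IsIrreducibleComponent Z (FoliationGerm.sing₂V U ω f))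
    (hZ2 : FoliationGerm.HasCodim 2 Z)
    (g h : FoliationGerm.Cn n → ℂ) (η : FoliationGerm.OneForm n)
    (hS : FoliationGerm.IsSaitoDecomposition U ω f g h η)
    (p : FoliationGerm.Cn n) (r : ℝ) (hp : FoliationGerm.IsGenericBall U ω f Z p r)
    (S : FoliationGerm.TransverseSection U f Z p r)
    (Γ : FoliationGerm.PositiveGenerator S)
    (hΓ : ∀ i t, g (Γ.curve i t) ≠ 0 ∧ h (Γ.curve i t) ≠ 0) :
    (∀ i, CurveIntegrable (FoliationGerm.saitoForm g h η) (Γ.curve i)) ∧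
    ∀ c : ℂ, FoliationGerm.IsVariationalIndex ω Γ c ↔
      c = 1 / (2 * Real.pi * Complex.I) * Γ.integral (FoliationGerm.saitoForm g h η) := by
  refine ⟨Γ.curveIntegrable_saitoForm hS.g_hol hS.h_hol hS.η_hol hΓ, fun c => ⟨?_, ?_⟩⟩
  · rintro ⟨β, hβ, rfl⟩
    rw [Γ.integral_eq_integral_saitoForm hU hω hf hS hp hΓ hβ]
  · rintro rfl
    -- One explicit solution suffices, since all solutions have the same integral.
    have hβ : FoliationGerm.IsGodbillonForm U ω f p r (FoliationGerm.godbillonForm ω) :=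
      FoliationGerm.isGodbillonForm_godbillonForm hω hp.subset fun _ hx => hp.ne_zero hx
    exact ⟨_, hβ, by rw [Γ.integral_eq_integral_saitoForm hU hω hf hS hp hΓ hβ]⟩
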